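/- Let $A'$, $B$ be finite-dimensional quantum systems with $A'\neq 0$, and let $\mathcal N:A'\to B$ be a quantum channel (a completely positive trace-preserving map) with an isometric extension $U: A'\hookrightarrow B\otimes E$, i.e. $\mathcal N(\rho)=\mathrm{Tr}_E(U\rho U^\dagger)$, $E$ finite-dimensional. Assume that $\mathcal N$ is anti-degradable: $\mathcal N=\mathcal D\circ\mathcal N_c$ for some channel $\mathcal D$, where $\mathcal N_c(\rho)=\mathrm{Tr}_B(V\rho V^\dagger)$ for some isometric extension $V:A'\hookrightarrow B\otimes E'$ of $\mathcal N$. For states let $F(\rho,\xi)=\|\sqrt\rho\sqrt\xi\|_1$ and $P(\rho,\xi)=\sqrt{1-F(\rho,\xi)^2}$. An $(n,\epsilon,\delta)$ private classical code with $M\ge1$ messages consists of an encoding channel $\mathcal E_n:X\to A'^n$ and a decoding channel $\mathcal D_n:B^n\to X$, with $|X|=|X'|=M$, such that, with $\rho^{XX'}=\frac1M\sum_m|m\rangle\langle m|^X\otimes|m\rangle\langle m|^{X'}$ and $\xi^{XE^nX'}$ the state obtained from $\rho^{XX'}$ by applying $\mathcal E_n$ to $X$, then $U^{\otimes n}$,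 then $\mathcal D_n$ to $B^n$, $$P(\xi^{XX'},\rho^{XX'})\le\epsilon,\qquad P\Big(\xi^{E^nX'},\ \omega^{E^n}\otimes\tfrac1M\sum_m|m\rangle\langle m|^{X'}\Big)\le\delta$$ for some state $\omega^{E^n}$ (independent of the message). Let $M(n,\epsilon,\delta)$ be the largest $M$ for which such a code exists ($\infty$ if there is no largest), and let the private classical capacity be $\mathcal P(\mathcal N)=\inf_{\epsilon,\delta>0}\liminf_{n\to\infty}\frac1n\log M(n,\epsilon,\delta)$. Logarithms are to base $2$. **Theorem.** Let $\epsilon,\delta\in[0,1]$, $\alpha=\arcsin\epsilon$, $\beta=\arcsin\delta$, and suppose that $$\delta\sqrt{1-\epsilon^2}+\epsilon\sqrt{1-\delta^2}<1\quad\text{and}\quad\alpha+\beta\le\tfrac{\pi}{2}$$ (together: $\alpha+\beta<\pi/2$). Then for every integer $n\ge0$ the maximum $M(n,\epsilon,\delta)$ exists, is finite, and satisfies $$\log M(n,\epsilon,\delta)\le 2\log\frac1{\cos(\alpha+\beta)} .$$ Consequently $\frac1n\log M(n,\epsilon,\delta)\to0$ as $n\to\infty$ for all such $\epsilon,\delta$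 (strong converse), and $\mathcal P(\mathcal N)=0$. -/

import Mathlib

open scoped Matrix Kronecker ComplexOrder MatrixOrder Topology ENNReal

noncomputable section

namespace QInfo

/-! Finite-dimensional quantum systems are given by finite index types `a`, `b`, `e`, ...
(labelling an orthonormal basis), operators on them are complex matrices, and the composite
of two systems `a` and `b` is indexed by `a × b`. -/

/-- Linear maps from operators on `a` to operators on `b`. -/
abbrev SuperOp (a b : Type*) := Matrix a a ℂ →ₗ[ℂ] Matrix b b ℂ

/-- `Φ ⊗ id_r`, a map from operators on `a × r` to operators on `b × r`. -/
def tensorId {a b : Type*} (Φ : SuperOp a b) (r : Type*) : SuperOp (a × r) (b × r) where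
  toFun X := Matrix.of fun p q => Φ (Matrix.of fun i j => X (i, p.2) (j, q.2)) p.1 q.1
  map_add' X Y := by
    ext p q
    change Φ ((Matrix.of fun i j => X (i, p.2) (j, q.2))
      + (Matrix.of fun i j => Y (i, p.2) (j, q.2))) p.1 q.1 = _
    rw [map_add]
    rfl
  map_smul' c X := by
    ext p q
    change Φ (c • (Matrix.of fun i j => X (i, p.2) (j, q.2))) p.1 q.1 = _
    rw [map_smul]
    rfl

/-- Complete positivity: `Φ ⊗ id_k` preserves positive semidefiniteness for every `k`. -/
def IsCompletelyPositive {a b : Type*} (Φ : SuperOp a b) : Prop :=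
  ∀ (k : ℕ) (X : Matrix (a × Fin k) (a × Fin k) ℂ),
    X.PosSemidef → (tensorId Φ (Fin k) X).PosSemidef

/-- Quantum channels: completely positive trace-preserving maps. -/
structure IsChannel {a b : Type*} [Fintype a] [Fintype b] (Φ : SuperOp a b) : Prop where
  completelyPositive : IsCompletelyPositive Φ
  trace_preserving : ∀ X, (Φ X).trace = X.trace

/-- Normalized states. -/
def IsState {a : Type*} [Fintype a] (ρ : Matrix a a ℂ) : Prop :=
  ρ.PosSemidef ∧ ρ.trace = 1

/-- Partial trace over the first factor. -/
def trFst (b e : Type*) [Fintype b] : SuperOp (b × e) e where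
  toFun X := Matrix.of fun i j => ∑ k, X (k, i) (k, j)
  map_add' X Y := by
    ext i j
    simp [Finset.sum_add_distrib]
  map_smul' c X := by
    ext i j
    simp [Finset.mul_sum]

/-- Partial trace over the second factor. -/
def trSnd (b e : Type*) [Fintype e] : SuperOp (b × e) b where
  toFun X := Matrix.of fun i j => ∑ k, X (i, k) (j, k)
  map_add' X Y := by
    ext i j
    simp [Finset.sum_add_distrib]
  map_smul' c X := by
    ext i j
    simp [Finset.mul_sum]

/-- The map `X ↦ U X U†`. -/
def conjBy {a c : Type*} [Fintype a] (U : Matrix c a ℂ) : SuperOp a c where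
  toFun X := U * X * Uᴴ
  map_add' X Y := by rw [Matrix.mul_add, Matrix.add_mul]
  map_smul' c X := by simp

/-- `U : a → b ⊗ e` is an isometry with `N(ρ) = Tr_e (U ρ U†)`. -/
structure IsIsometricExtension {a b e : Type*} [Fintype a] [DecidableEq a] [Fintype b]
    [Fintype e] (U : Matrix (b × e) a ℂ) (N : SuperOp a b) : Prop where
  isometry : Uᴴ * U = 1
  extends_channel : ∀ ρ, N ρ = trSnd b e (conjBy U ρ)

/-- The complementary channel `ρ ↦ Tr_b (U ρ U†)` of an isometric extension. -/
def complementary {a b e : Type*} [Fintype a] [Fintype b] (U : Matrix (b × e) a ℂ) :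
    SuperOp a e :=
  trFst b e ∘ₗ conjBy U

/-- `N` is anti-degradable: `N = D ∘ N_c` for a channel `D`, where `N_c` is a complementary
channel of `N`, defined through some isometric extension. -/
def IsAntidegradable {a b : Type*} [Fintype a] [DecidableEq a] [Fintype b]
    (N : SuperOp a b) : Prop :=
  ∃ (k : ℕ) (V : Matrix (b × Fin k) a ℂ), IsIsometricExtension V N ∧
    ∃ D : SuperOp (Fin k) b, IsChannel D ∧ N = D ∘ₗ complementary V

/-- `U^{⊗ n}`, with the `n` copies of `b` and the `n` copies of `e` grouped together. -/
def tensorPow {a b e : Type*} (U : Matrix (b × e) a ℂ) (n : ℕ) :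
    Matrix ((Fin n → b) × (Fin n → e)) (Fin n → a) ℂ :=
  Matrix.of fun p x => ∏ i, U (p.1 i, p.2 i) (x i)

/-- The trace norm `‖X‖₁ = Tr √(X† X)`. -/
def traceNorm {a : Type*} [Fintype a] [DecidableEq a] (X : Matrix a a ℂ) : ℝ :=
  (CFC.sqrt (Xᴴ * X)).trace.re

/-- The fidelity `F(ρ, ξ) = ‖√ρ √ξ‖₁` of two states. -/
def fidelity {a : Type*} [Fintype a] [DecidableEq a] (ρ ξ : Matrix a a ℂ) : ℝ :=
  traceNorm (CFC.sqrt ρ * CFC.sqrt ξ)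

/-- The purified distance `P(ρ, ξ) = √(1 - F(ρ, ξ)²)` of two states. -/
def purifiedDist {a : Type*} [Fintype a] [DecidableEq a] (ρ ξ : Matrix a a ℂ) : ℝ :=
  Real.sqrt (1 - fidelity ρ ξ ^ 2)

/-- The maximally mixed state `∑ m, (1/M) |m⟩⟨m|` on the message register. -/
def uniformState (M : ℕ) : Matrix (Fin M) (Fin M) ℂ :=
  ∑ m, (1 / (M : ℂ)) • Matrix.single m m 1

/-- The perfectly correlated state `∑ m, (1/M) |m⟩⟨m| ⊗ |m⟩⟨m|` on two message registers. -/
def correlatedState (M : ℕ) : Matrix (Fin M × Fin M) (Fin M × Fin M) ℂ :=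
  ∑ m, (1 / (M : ℂ)) • (Matrix.single m m 1 ⊗ₖ Matrix.single m m 1)

section Codes

variable {a b e : Type*} [Fintype a] [DecidableEq a] [Fintype b] [DecidableEq b]
  [Fintype e] [DecidableEq e]

/-- The state on `(X × E^n) × X'` after encoding one half `X` of the correlated state, sending
it through `U^{⊗ n}`, and decoding the `B^n` part. -/
def outputState (U : Matrix (b × e) a ℂ) {n M : ℕ}
    (enc : SuperOp (Fin M) (Fin n → a)) (dec : SuperOp (Fin n → b) (Fin M)) :
    Matrix ((Fin M × (Fin n → e)) × Fin M) ((Fin M × (Fin n → e)) × Fin M) ℂ :=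
  tensorId (tensorId dec (Fin n → e)) (Fin M)
    (tensorId (conjBy (tensorPow U n)) (Fin M)
      (tensorId enc (Fin M) (correlatedState M)))

/-- An `(n, ε, δ)` private classical code with `M` messages for the channel with isometric
extension `U`; the state `omega` of the environment does not depend on the message. -/
structure PrivateCode (U : Matrix (b × e) a ℂ) (n M : ℕ) (ε δ : ℝ) where
  enc : SuperOp (Fin M) (Fin n → a)
  enc_channel : IsChannel enc
  dec : SuperOp (Fin n → b) (Fin M)
  dec_channel : IsChannel dec
  omega : Matrix (Fin n → e) (Fin n → e) ℂ
  omega_state : IsState omega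
  error_le : purifiedDist
    (tensorId (trSnd (Fin M) (Fin n → e)) (Fin M) (outputState U enc dec))
    (correlatedState M) ≤ ε
  privacy_le : purifiedDist
    (tensorId (trFst (Fin M) (Fin n → e)) (Fin M) (outputState U enc dec))
    (omega ⊗ₖ uniformState M) ≤ δ

/-- The numbers of messages `M ≥ 1` for which an `(n, ε, δ)` private classical code exists. -/
def privateSizes (U : Matrix (b × e) a ℂ) (n : ℕ) (ε δ : ℝ) : Set ℕ :=
  {M | 0 < M ∧ Nonempty (PrivateCode U n M ε δ)}

/-- `M(n, ε, δ)`, the largest number of messages (`⊤` if there are arbitrarily large codes). -/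
def maxMessages (U : Matrix (b × e) a ℂ) (n : ℕ) (ε δ : ℝ) : ℕ∞ :=
  ⨆ M ∈ privateSizes U n ε δ, (M : ℕ∞)

/-- The rate `(1/n) log₂ M(n, ε, δ)`. -/
def privateRate (U : Matrix (b × e) a ℂ) (n : ℕ) (ε δ : ℝ) : EReal :=
  (((n : ℝ)⁻¹ : ℝ) : EReal) *
    (ENNReal.log (maxMessages U n ε δ : ℝ≥0∞) / ((Real.log 2 : ℝ) : EReal))

/-- The private classical capacity `inf_{ε, δ > 0} liminf_n (1/n) log₂ M(n, ε, δ)`. -/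
def privateCapacity (U : Matrix (b × e) a ℂ) : EReal :=
  ⨅ (ε : ℝ) (δ : ℝ) (_ : 0 < ε) (_ : 0 < δ),
    Filter.liminf (fun n : ℕ => privateRate U n ε δ) Filter.atTop

end Codes

end QInfo

end

open QInfo

namespace QInfo

open Matrix

/-! ### Linear algebra -/

section LinearAlgebra

variable {m n l : Type*} [Fintype m] [Fintype n] [Fintype l]

/-! Anti-degradability lets the environment imitate the decoder: recovering the output from `E^n`
and then decoding gives effects `Γ m` on `E^n`, with sum at most the identity, that reproduce the
decoder's statistics (`exists_environment_effects`). A reliable code makes these effects guess the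
message well, while privacy makes the environment state nearly independent of the message, so that
the guess can succeed with probability at most about `1/M`. The trade-off is quantified by angles.
With `c = 1/M`, let `p m` and `q m` be the weights that `Γ m` assigns to the actual and to the ideal
environment state, and consider the unit vectors `x = (√p, √(c - p))`, `y = (√q, √(c - q))`, `z =
(√c, 0)`. Monotonicity of fidelity under measurement (`fidelity_le_sum_measurement`) turns the error
condition into `∠(x, z) ≤ α` and the privacy condition into `∠(y, x) ≤ β`. The triangle inequality
and Cauchy–Schwarz give `cos (α + β) ≤ ⟨y, z⟩ ≤ √(∑ q) ≤ √(1/M)` (`cos_add_le_sqrt`), which bounds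
`M` uniformly in `n`. -/

theorem exists_gram [DecidableEq n] {A : Matrix n n ℂ} (hA : A.PosSemidef) :
    ∃ G : Matrix n n ℂ, Gᴴ * G = A := by
  refine ⟨CFC.sqrt A, ?_⟩
  have h := (nonneg_iff_posSemidef.1 (CFC.sqrt_nonneg A)).1
  rw [h.eq]
  exact CFC.sqrt_mul_sqrt_self A (nonneg_iff_posSemidef.2 hA)

theorem trace_nonneg_re {A : Matrix n n ℂ} (hA : A.PosSemidef) : 0 ≤ A.trace.re :=
  (Complex.le_def.1 hA.trace_nonneg).1

theorem trace_mul_nonneg_re [DecidableEq n] {A B : Matrix n n ℂ} (hA : A.PosSemidef)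
    (hB : B.PosSemidef) : 0 ≤ (A * B).trace.re := by
  obtain ⟨G, rfl⟩ := exists_gram hA
  rw [Matrix.mul_assoc, Matrix.trace_mul_comm]
  exact trace_nonneg_re (hB.mul_mul_conjTranspose_same G)

/-- Contractivity of `W` is recorded by a complement `S` for which the stacked matrix is an
isometry; tensor powers are later handled through that isometry. -/
theorem re_trace_conj_le [DecidableEq n] {W : Matrix m n ℂ} {S : Matrix l n ℂ}
    (h : Wᴴ * W + Sᴴ * S = 1) {Z : Matrix n n ℂ} (hZ : Z.PosSemidef) :
    (W * Z * Wᴴ).trace.re ≤ Z.trace.re := by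
  have h1 : (W * Z * Wᴴ).trace + (S * Z * Sᴴ).trace = Z.trace := by
    rw [Matrix.trace_mul_comm (W * Z), Matrix.trace_mul_comm (S * Z), ← Matrix.mul_assoc,
      ← Matrix.mul_assoc, ← Matrix.trace_add, ← Matrix.add_mul, h, Matrix.one_mul]
  have h2 := trace_nonneg_re (hZ.mul_mul_conjTranspose_same S)
  rw [← h1, Complex.add_re]
  linarith

/-- Cauchy–Schwarz for the Hilbert–Schmidt inner product. -/
theorem re_trace_mul_le (A : Matrix m n ℂ) (B : Matrix n m ℂ) :
    (A * B).trace.re ≤ √(A * Aᴴ).trace.re * √(Bᴴ * B).trace.re := by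
  have e1 : (A * B).trace.re ≤ ∑ p : m × n, ‖A p.1 p.2‖ * ‖B p.2 p.1‖ := by
    simp only [Matrix.trace, Matrix.diag, Matrix.mul_apply, Fintype.sum_prod_type, Complex.re_sum]
    refine Finset.sum_le_sum fun i _ => Finset.sum_le_sum fun j _ => ?_
    rw [← norm_mul]
    exact Complex.re_le_norm _
  refine e1.trans ((Real.sum_mul_le_sqrt_mul_sqrt _ _ _).trans (le_of_eq ?_))
  congr 2
  · simp only [Matrix.trace, Matrix.diag, Matrix.mul_apply, Fintype.sum_prod_type, Complex.re_sum,
      Matrix.conjTranspose_apply, Complex.star_def, Complex.mul_conj, Complex.ofReal_re,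
      Complex.normSq_eq_norm_sq]
  · simp only [Matrix.trace, Matrix.diag, Matrix.mul_apply, Fintype.sum_prod_type, Complex.re_sum,
      Matrix.conjTranspose_apply, Complex.star_def, mul_comm ((starRingEnd ℂ) _), Complex.mul_conj,
      Complex.ofReal_re, Complex.normSq_eq_norm_sq]

/-- A `{1,3}`-inverse. -/
theorem exists_inner_inverse [DecidableEq n] (A : Matrix m n ℂ) :
    ∃ H : Matrix n m ℂ, A * H * A = A ∧ (A * H)ᴴ = A * H := by
  have hC : (Aᴴ * A).IsHermitian := isHermitian_conjTranspose_mul_self A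
  obtain ⟨C', h1, h2⟩ : ∃ C' : Matrix n n ℂ, C'ᴴ = C' ∧ Aᴴ * A * C' * (Aᴴ * A) = Aᴴ * A := by
    set V : Matrix n n ℂ := hC.eigenvectorUnitary.1
    set D : Matrix n n ℂ := diagonal (RCLike.ofReal ∘ hC.eigenvalues)
    -- As `0⁻¹ = 0`, this inverts `D` on its support only.
    set D' : Matrix n n ℂ := diagonal (RCLike.ofReal ∘ fun i => (hC.eigenvalues i)⁻¹)
    have hV : Vᴴ * V = 1 := Unitary.coe_star_mul_self hC.eigenvectorUnitary
    have hs : Aᴴ * A = V * D * Vᴴ := hC.spectral_theorem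
    have hD : D * D' * D = D := by
      simp only [D, D', diagonal_mul_diagonal]
      congr 1
      ext i
      by_cases h : hC.eigenvalues i = 0 <;> simp [h]
    have hD' : D'ᴴ = D' := by
      simp only [D', diagonal_conjTranspose]
      congr 1
      ext i
      simp
    refine ⟨V * D' * Vᴴ, ?_, ?_⟩
    · simp [hD', Matrix.mul_assoc]
    · rw [hs]
      calc V * D * Vᴴ * (V * D' * Vᴴ) * (V * D * Vᴴ)
          = V * D * (Vᴴ * V) * D' * (Vᴴ * V) * D * Vᴴ := by simp only [Matrix.mul_assoc]
        _ = V * (D * D' * D) * Vᴴ := by simp only [hV, Matrix.mul_one, Matrix.mul_assoc]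
        _ = _ := by rw [hD]
  refine ⟨C' * Aᴴ, ?_, ?_⟩
  -- A matrix with zero Gram matrix vanishes, so it suffices to multiply by `Aᴴ`, where the identity
  -- for `C'` applies.
  · rw [← sub_eq_zero, ← conjTranspose_mul_self_eq_zero]
    have e : A * (C' * Aᴴ) * A - A = A * (C' * (Aᴴ * A) - 1) := by
      simp only [Matrix.mul_sub, Matrix.mul_assoc, Matrix.mul_one]
    rw [e, conjTranspose_mul, Matrix.mul_assoc, ← Matrix.mul_assoc Aᴴ, Matrix.mul_sub,
      ← Matrix.mul_assoc (Aᴴ * A), h2, Matrix.mul_one, sub_self, Matrix.mul_zero]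
  · simp [h1, Matrix.mul_assoc]

/-- Two matrices with the same Gram matrix differ by a contraction. -/
theorem exists_contraction_of_gram_eq [DecidableEq m] [DecidableEq n] (A : Matrix m n ℂ)
    (B : Matrix l n ℂ) (h : Aᴴ * A = Bᴴ * B) :
    ∃ (W : Matrix l m ℂ) (S : Matrix m m ℂ), B = W * A ∧ Wᴴ * W + Sᴴ * S = 1 := by
  obtain ⟨H, h1, h2⟩ := exists_inner_inverse A
  have hP : A * H * (A * H) = A * H := by rw [← Matrix.mul_assoc, h1]
  -- `A * H` is the orthogonal projection onto the range of `A`. Equality of the Gram matrices makes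
  -- it equal to `Wᴴ * W`, so the complementary projection serves as `S`.
  refine ⟨B * H, 1 - A * H, ?_, ?_⟩
  · rw [eq_comm, ← sub_eq_zero, ← conjTranspose_mul_self_eq_zero]
    have e : B * H * A - B = B * (H * A - 1) := by
      simp only [Matrix.mul_sub, Matrix.mul_assoc, Matrix.mul_one]
    rw [e, conjTranspose_mul, Matrix.mul_assoc, ← Matrix.mul_assoc Bᴴ, ← h, Matrix.mul_assoc,
      Matrix.mul_sub, ← Matrix.mul_assoc A, h1, Matrix.mul_one, sub_self, Matrix.mul_zero,
      Matrix.mul_zero]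
  · have e : (B * H)ᴴ * (B * H) = A * H := by
      rw [conjTranspose_mul, Matrix.mul_assoc, ← Matrix.mul_assoc Bᴴ, ← h, Matrix.mul_assoc,
        ← Matrix.mul_assoc Hᴴ, ← conjTranspose_mul, h2, hP]
    rw [e, conjTranspose_sub, h2, conjTranspose_one]
    simp only [Matrix.sub_mul, Matrix.mul_sub, Matrix.one_mul, Matrix.mul_one, hP]
    abel

end LinearAlgebra

/-! ### Fidelity -/

section Fidelity

variable {n : Type*} [Fintype n] [DecidableEq n]

theorem posSemidef_sqrt (A : Matrix n n ℂ) : (CFC.sqrt A).PosSemidef :=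
  nonneg_iff_posSemidef.1 (CFC.sqrt_nonneg A)

theorem sqrt_mul_sqrt {A : Matrix n n ℂ} (hA : A.PosSemidef) : CFC.sqrt A * CFC.sqrt A = A :=
  CFC.sqrt_mul_sqrt_self A (nonneg_iff_posSemidef.2 hA)

theorem traceNorm_nonneg (X : Matrix n n ℂ) : 0 ≤ traceNorm X :=
  trace_nonneg_re (posSemidef_sqrt _)

/-- The fidelity does not exceed the Bhattacharyya coefficient of any measurement. -/
theorem fidelity_le_sum_measurement {ι : Type*} [Fintype ι] {ρ ξ : Matrix n n ℂ}
    (hρ : ρ.PosSemidef) (hξ : ξ.PosSemidef) (Γ : ι → Matrix n n ℂ)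
    (hΓ : ∀ i, (Γ i).PosSemidef) (hsum : ∑ i, Γ i = 1) :
    fidelity ρ ξ ≤ ∑ i, √(Γ i * ρ).trace.re * √(Γ i * ξ).trace.re := by
  set r := CFC.sqrt ρ with hr
  set x := CFC.sqrt ξ with hx
  have hr1 : rᴴ = r := (posSemidef_sqrt ρ).1
  have hx1 : xᴴ = x := (posSemidef_sqrt ξ).1
  have hr2 : r * r = ρ := sqrt_mul_sqrt hρ
  have hx2 : x * x = ξ := sqrt_mul_sqrt hξ
  set Y := CFC.sqrt ((r * x)ᴴ * (r * x)) with hY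
  have hg : (r * x)ᴴ * (r * x) = Yᴴ * Y := by
    rw [(posSemidef_sqrt _).1.eq, sqrt_mul_sqrt (posSemidef_conjTranspose_mul_self _)]
  -- In place of a polar decomposition: `Y = |r x|` equals `W * (r * x)`, and a contraction is
  -- enough for an upper bound.
  obtain ⟨W, S, hW, hWS⟩ := exists_contraction_of_gram_eq _ _ hg
  have e : fidelity ρ ξ = ∑ i, (W * r * Γ i * x).trace.re := by
    calc fidelity ρ ξ = (W * (r * x)).trace.re := by rw [← hW]; rfl
      _ = (W * r * (∑ i, Γ i) * x).trace.re := by rw [hsum]; simp only [Matrix.mul_assoc,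
          Matrix.one_mul]
      _ = _ := by rw [Matrix.mul_sum, Matrix.sum_mul, Matrix.trace_sum, Complex.re_sum]
  rw [e]
  refine Finset.sum_le_sum fun i _ => ?_
  -- Splitting `Γ i = Gᴴ * G` between the two square roots lets Cauchy–Schwarz act on each outcome
  -- separately; contractivity then removes `W`.
  obtain ⟨G, hG⟩ := exists_gram (hΓ i)
  have e1 : W * r * Γ i * x = (W * r * Gᴴ) * (G * x) := by rw [← hG]; simp only [Matrix.mul_assoc]
  rw [e1]
  refine (re_trace_mul_le _ _).trans (mul_le_mul (Real.sqrt_le_sqrt ?_) (Real.sqrt_le_sqrt ?_)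
    (Real.sqrt_nonneg _) (Real.sqrt_nonneg _))
  · have e2 : W * r * Gᴴ * (W * r * Gᴴ)ᴴ = W * ((r * Gᴴ) * (r * Gᴴ)ᴴ) * Wᴴ := by
      simp only [conjTranspose_mul, Matrix.mul_assoc]
    rw [e2]
    refine (re_trace_conj_le hWS (posSemidef_self_mul_conjTranspose _)).trans (le_of_eq ?_)
    rw [conjTranspose_mul, hr1, conjTranspose_conjTranspose, Matrix.mul_assoc,
      ← Matrix.mul_assoc Gᴴ, hG, Matrix.trace_mul_comm, Matrix.mul_assoc, hr2]
  · rw [conjTranspose_mul, hx1, Matrix.mul_assoc, ← Matrix.mul_assoc Gᴴ, hG,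
      Matrix.trace_mul_comm, Matrix.mul_assoc, hx2]

theorem fidelity_self {ρ : Matrix n n ℂ} (hρ : ρ.PosSemidef) : fidelity ρ ρ = ρ.trace.re := by
  unfold fidelity traceNorm
  rw [sqrt_mul_sqrt hρ, hρ.1.eq, CFC.sqrt_mul_self ρ (nonneg_iff_posSemidef.2 hρ)]

theorem purifiedDist_self {ρ : Matrix n n ℂ} (hρ : IsState ρ) : purifiedDist ρ ρ = 0 := by
  simp [purifiedDist, fidelity_self hρ.1, hρ.2]

theorem sqrt_one_sub_sq_le_fidelity {ρ ξ : Matrix n n ℂ} {ε : ℝ}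
    (h : purifiedDist ρ ξ ≤ ε) : √(1 - ε ^ 2) ≤ fidelity ρ ξ := by
  refine Real.sqrt_le_iff.2 ⟨traceNorm_nonneg _, ?_⟩
  have h1 := (Real.sqrt_le_iff.1 h).2
  linarith

end Fidelity

/-! ### Channels -/

section Channels

variable {a b e r : Type*}

/-- The `(s, t)` block of an operator on a composite system. -/
def block (X : Matrix (a × r) (a × r) ℂ) (s t : r) : Matrix a a ℂ :=
  Matrix.of fun i j => X (i, s) (j, t)

theorem block_tensorId (Φ : SuperOp a b) (X : Matrix (a × r) (a × r) ℂ) (s t : r) :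
    block (tensorId Φ r X) s t = Φ (block X s t) := rfl

theorem superOp_ext [Finite a] [DecidableEq a] {Φ Ψ : SuperOp a b}
    (h : ∀ x y, Φ (single x y 1) = Ψ (single x y 1)) : Φ = Ψ := by
  refine Matrix.ext_linearMap ℂ fun i j => LinearMap.ext_ring ?_
  simpa using h i j

theorem conjBy_single_apply [Fintype a] [DecidableEq a] (U : Matrix b a ℂ) (x y : a) (p q : b) :
    conjBy U (single x y 1) p q = U p x * star (U q y) := by
  change (U * single x y (1 : ℂ) * Uᴴ) p q = _
  rw [Matrix.mul_apply, Finset.sum_eq_single y]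
  · simp
  · intro z _ hz
    simp [Matrix.mul_single_apply_of_ne _ _ _ _ _ hz]
  · simp

theorem conjBy_posSemidef [Fintype a] [Finite b] (U : Matrix b a ℂ) {X : Matrix a a ℂ}
    (hX : X.PosSemidef) : (conjBy U X).PosSemidef :=
  hX.mul_mul_conjTranspose_same U

theorem conjBy_trace [Fintype a] [DecidableEq a] [Fintype b] {U : Matrix b a ℂ}
    (hU : Uᴴ * U = 1) (X : Matrix a a ℂ) : (conjBy U X).trace = X.trace := by
  change (U * X * Uᴴ).trace = _
  rw [Matrix.trace_mul_comm, ← Matrix.mul_assoc, hU, Matrix.one_mul]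

theorem trSnd_posSemidef [Fintype e] {X : Matrix (b × e) (b × e) ℂ}
    (hX : X.PosSemidef) : (trSnd b e X).PosSemidef := by
  have h : trSnd b e X = ∑ k, X.submatrix (fun i => (i, k)) (fun i => (i, k)) := by
    ext i j
    simp [trSnd, Matrix.sum_apply]
  rw [h]
  exact posSemidef_sum _ fun k _ => hX.submatrix _

theorem trFst_posSemidef [Fintype b] {X : Matrix (b × e) (b × e) ℂ}
    (hX : X.PosSemidef) : (trFst b e X).PosSemidef := by
  have h : trFst b e X = ∑ k, X.submatrix (fun i => (k, i)) (fun i => (k, i)) := by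
    ext i j
    simp [trFst, Matrix.sum_apply]
  rw [h]
  exact posSemidef_sum _ fun k _ => hX.submatrix _

theorem trSnd_trace [Fintype b] [Fintype e] (X : Matrix (b × e) (b × e) ℂ) :
    (trSnd b e X).trace = X.trace := by
  simp [trSnd, Matrix.trace, Fintype.sum_prod_type]

theorem trFst_trace [Fintype b] [Fintype e] (X : Matrix (b × e) (b × e) ℂ) :
    (trFst b e X).trace = X.trace := by
  simp [trFst, Matrix.trace, Fintype.sum_prod_type_right]

theorem IsChannel.posSemidef [Fintype a] [Fintype b] {Φ : SuperOp a b} (h : IsChannel Φ)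
    {X : Matrix a a ℂ} (hX : X.PosSemidef) : (Φ X).PosSemidef :=
  (h.completelyPositive 1 _ (hX.submatrix Prod.fst)).submatrix fun i => (i, 0)

/-- Kraus operators of a completely positive map, collected into one matrix. -/
theorem IsCompletelyPositive.exists_kraus [Fintype b] [DecidableEq b] {k : ℕ}
    {D : SuperOp (Fin k) b} (hD : IsCompletelyPositive D) :
    ∃ K : Matrix (b × (b × Fin k)) (Fin k) ℂ, D = trSnd b (b × Fin k) ∘ₗ conjBy K := by
  -- The unnormalized maximally entangled vector. Its image under `D ⊗ id` is the Choi matrix, and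
  -- the conjugated rows of a Gram factor of that matrix are the Kraus operators.
  let φ : Fin k × Fin k → ℂ := fun i => if i.1 = i.2 then 1 else 0
  have h := hD k _ (posSemidef_vecMulVec_self_star φ)
  obtain ⟨G, hG⟩ := exists_gram h
  have hblock : ∀ s t, block (vecMulVec φ (star φ)) s t = single s t (1 : ℂ) := by
    intro s t
    ext i j
    by_cases h1 : i = s <;> by_cases h2 : j = t <;>
      simp [block, vecMulVec_apply, φ, h1, h2, eq_comm (a := s),
        eq_comm (a := t)]
  refine ⟨Matrix.of fun p s => star (G p.2 (p.1, s)), superOp_ext fun s t => ?_⟩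
  ext p q
  have h1 := congrFun (congrFun hG (p, s)) (q, t)
  change _ = D (block (vecMulVec φ (star φ)) s t) p q at h1
  rw [← hblock, ← h1, hblock]
  change _ = ∑ r, conjBy _ (single s t 1) (p, r) (q, r)
  simp only [conjBy_single_apply, Matrix.mul_apply, Matrix.of_apply, star_star,
    conjTranspose_apply]

theorem isometry_of_trace_preserving [Fintype a] [DecidableEq a] [Fintype b] {K : Matrix b a ℂ}
    (h : ∀ X, (conjBy K X).trace = X.trace) : Kᴴ * K = 1 := by
  refine Matrix.ext_iff_trace_mul_left.2 fun X => ?_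
  rw [Matrix.mul_one, ← Matrix.mul_assoc, Matrix.trace_mul_comm, ← Matrix.mul_assoc]
  exact h X

end Channels

/-! ### Degrading the environment -/

section Degrading

variable {a b e r : Type*} [Fintype a] [DecidableEq a]

theorem complementary_single_apply [Fintype b] (U : Matrix (b × e) a ℂ) (x y : a) (k l : e) :
    complementary U (single x y 1) k l = ∑ p, U (p, k) x * star (U (p, l) y) := by
  change ∑ p, conjBy U (single x y 1) (p, k) (p, l) = _
  simp only [conjBy_single_apply]

theorem trSnd_conjBy_single_apply [Fintype e] (U : Matrix (b × e) a ℂ) (x y : a) (p q : b) :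
    trSnd b e (conjBy U (single x y 1)) p q = ∑ k, U (p, k) x * star (U (q, k) y) := by
  change ∑ k, conjBy U (single x y 1) (p, k) (q, k) = _
  simp only [conjBy_single_apply]

theorem trSnd_conjBy_apply [Fintype e] [Fintype r] (T : Matrix (b × r) e ℂ) (X : Matrix e e ℂ) (p q : b) :
    trSnd b r (conjBy T X) p q = ∑ j, ∑ l, ∑ k, T (p, j) k * X k l * star (T (q, j) l) := by
  change ∑ j, (T * X * Tᴴ) (p, j) (q, j) = _
  simp only [Matrix.mul_apply, Finset.sum_mul, conjTranspose_apply]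

/-- On matrix units every entry factors over the `n` positions, so the one-copy identities multiply;
expanding a product of sums gives the sum over tuples. -/
theorem tensorPow_recovery [Fintype b] [Fintype e] [Fintype r] {U : Matrix (b × e) a ℂ} {T : Matrix (b × r) e ℂ}
    (h : trSnd b e ∘ₗ conjBy U = trSnd b r ∘ₗ conjBy T ∘ₗ complementary U) (n : ℕ) :
    trSnd (Fin n → b) (Fin n → e) ∘ₗ conjBy (tensorPow U n) =
      trSnd (Fin n → b) (Fin n → r) ∘ₗ conjBy (tensorPow T n) ∘ₗ
        complementary (tensorPow U n) := by
  refine superOp_ext fun x y => ?_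
  ext p q
  rw [LinearMap.comp_apply, LinearMap.comp_apply, LinearMap.comp_apply,
    trSnd_conjBy_single_apply, trSnd_conjBy_apply]
  simp only [complementary_single_apply]
  have h1 : ∀ i, ∑ k, U (p i, k) (x i) * star (U (q i, k) (y i)) =
      ∑ j, ∑ l, ∑ k, T (p i, j) k * (∑ m, U (m, k) (x i) * star (U (m, l) (y i))) *
        star (T (q i, j) l) := by
    intro i
    have := congrFun (congrFun (LinearMap.congr_fun h (single (x i) (y i) 1)) (p i)) (q i)
    rw [LinearMap.comp_apply, LinearMap.comp_apply, LinearMap.comp_apply,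
      trSnd_conjBy_single_apply, trSnd_conjBy_apply] at this
    simpa only [complementary_single_apply] using this
  have h2 := Finset.prod_congr (rfl : (Finset.univ : Finset (Fin n)) = _) fun i _ => h1 i
  simp only [Finset.mul_sum, Finset.sum_mul, Fintype.prod_sum, Finset.prod_mul_distrib,
    ← star_prod] at h2
  simp only [Finset.mul_sum, Finset.sum_mul, tensorPow, Matrix.of_apply]
  exact h2

variable [Fintype b] [DecidableEq b] [Fintype e] [DecidableEq e]

/-- For an anti-degradable channel, a trace-non-increasing completely positive map recovers the
output from the environment of an arbitrary isometric extension. -/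
theorem IsAntidegradable.exists_recovery {N : SuperOp a b} (hanti : IsAntidegradable N)
    {U : Matrix (b × e) a ℂ} (hU : IsIsometricExtension U N) :
    ∃ (k : ℕ) (T : Matrix (b × (b × Fin k)) e ℂ) (S : Matrix e e ℂ), Tᴴ * T + Sᴴ * S = 1 ∧
      trSnd b e ∘ₗ conjBy U = trSnd b (b × Fin k) ∘ₗ conjBy T ∘ₗ complementary U := by
  obtain ⟨k, V, hV, D, hD, hND⟩ := hanti
  obtain ⟨K, rfl⟩ := hD.completelyPositive.exists_kraus
  have hK : Kᴴ * K = 1 := isometry_of_trace_preserving fun X => by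
    rw [← hD.trace_preserving X, LinearMap.comp_apply, trSnd_trace]
  -- Reshaping with the environment as row index turns the Gram matrix into the Choi matrix of `N`,
  -- up to transposition, which does not depend on the extension. Hence the two environments are
  -- related by a contraction `W`, which need not be an isometry since their dimensions may differ.
  let A : Matrix e (b × a) ℂ := Matrix.of fun k p => U (p.1, k) p.2
  let B : Matrix (Fin k) (b × a) ℂ := Matrix.of fun k p => V (p.1, k) p.2
  have hAB : Aᴴ * A = Bᴴ * B := by
    ext ⟨p, x⟩ ⟨q, y⟩
    have h1 := congrFun (congrFun (hU.extends_channel (single y x 1)) q) p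
    rw [hV.extends_channel, trSnd_conjBy_single_apply, trSnd_conjBy_single_apply] at h1
    simp only [Matrix.mul_apply, conjTranspose_apply, A, B, Matrix.of_apply]
    simpa only [mul_comm] using h1.symm
  obtain ⟨W, S, hW, hWS⟩ := exists_contraction_of_gram_eq A B hAB
  have hVW : ∀ p j x, V (p, j) x = ∑ i, W j i * U (p, i) x := fun p j x =>
    congrFun (congrFun hW j) (p, x)
  have hcomp : complementary V = conjBy W ∘ₗ complementary U := by
    refine superOp_ext fun x y => ?_
    ext i j
    change _ = (W * complementary U (single x y 1) * Wᴴ) i j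
    simp only [complementary_single_apply, Matrix.mul_apply, hVW, conjTranspose_apply,
      Finset.mul_sum, Finset.sum_mul, star_sum, star_mul']
    rw [Finset.sum_comm]
    refine Finset.sum_congr rfl fun l _ => ?_
    rw [Finset.sum_comm]
    refine Finset.sum_congr rfl fun m _ => Finset.sum_congr rfl fun p _ => ?_
    ring
  refine ⟨k, K * W, S, ?_, ?_⟩
  · rw [conjTranspose_mul, Matrix.mul_assoc, ← Matrix.mul_assoc Kᴴ, hK, Matrix.one_mul, hWS]
  · have hNU : N = trSnd b e ∘ₗ conjBy U := LinearMap.ext hU.extends_channel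
    rw [← hNU, hND, hcomp]
    ext1 X
    simp [conjBy, Matrix.mul_assoc]

end Degrading

/-! ### Tensor powers of contractions; effects from positive functionals -/

section TensorPower

variable {c e : Type*} [Fintype c]

theorem prod_isometry [DecidableEq e] {M : Matrix c e ℂ} (hM : Mᴴ * M = 1) (n : ℕ) :
    (Matrix.of fun (p : Fin n → c) (x : Fin n → e) => ∏ i, M (p i) (x i))ᴴ *
      (Matrix.of fun (p : Fin n → c) (x : Fin n → e) => ∏ i, M (p i) (x i)) = 1 := by
  ext x y
  have h1 : ∀ i, _ := fun i => congrFun (congrFun hM (x i)) (y i)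
  have h2 := Finset.prod_congr (rfl : (Finset.univ : Finset (Fin n)) = _) fun i _ => h1 i
  simp only [Matrix.mul_apply, conjTranspose_apply, Fintype.prod_sum, Finset.prod_mul_distrib,
    ← star_prod] at h2
  simp only [Matrix.mul_apply, conjTranspose_apply, Matrix.of_apply, h2, Matrix.one_apply,
    Finset.prod_ite_zero, Finset.prod_const_one, Finset.mem_univ, forall_const, funext_iff]

variable [Fintype e]

theorem tensorPow_isometry {b a : Type*} [Fintype b] [Fintype a] [DecidableEq a]
    {U : Matrix (b × e) a ℂ} (hU : Uᴴ * U = 1) (n : ℕ) :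
    (tensorPow U n)ᴴ * tensorPow U n = 1 := by
  have h := prod_isometry hU n
  let f : (Fin n → b) × (Fin n → e) ≃ (Fin n → b × e) := (Equiv.arrowProdEquivProdArrow _ _ _).symm
  have h2 : tensorPow U n = (Matrix.of fun (p : Fin n → b × e) (x : Fin n → a) =>
      ∏ i, U (p i) (x i)).submatrix f id := rfl
  rw [h2, conjTranspose_submatrix, submatrix_mul_equiv, h, submatrix_one _ Function.injective_id]

/-- Tensor powers of contractions do not increase the trace. -/
theorem re_trace_conjBy_tensorPow_le [DecidableEq e] {b r : Type*} [Fintype b] [Fintype r]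
    {T : Matrix (b × r) e ℂ} {S : Matrix e e ℂ} (h : Tᴴ * T + Sᴴ * S = 1) (n : ℕ)
    {Z : Matrix (Fin n → e) (Fin n → e) ℂ} (hZ : Z.PosSemidef) :
    (conjBy (tensorPow T n) Z).trace.re ≤ Z.trace.re := by
  have h0 : (Matrix.fromRows T S)ᴴ * Matrix.fromRows T S = 1 := by
    rw [conjTranspose_fromRows_eq_fromCols_conjTranspose, fromCols_mul_fromRows, h]
  let M := Matrix.of fun (p : Fin n → (b × r) ⊕ e) (x : Fin n → e) =>
    ∏ i, Matrix.fromRows T S (p i) (x i)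
  have hM : Mᴴ * M = 1 := prod_isometry h0 n
  -- The power of `T` consists of the rows of the isometry `M` that select the `T` block at every
  -- position. Its trace is therefore a partial sum of non-negative diagonal entries.
  let f : (Fin n → b) × (Fin n → r) → (Fin n → (b × r) ⊕ e) := fun p i => Sum.inl (p.1 i, p.2 i)
  have hf : Function.Injective f := by
    intro p q hpq
    have h1 : ∀ i, p.1 i = q.1 i ∧ p.2 i = q.2 i := fun i => by
      simpa [f] using congrFun hpq i
    exact Prod.ext (funext fun i => (h1 i).1) (funext fun i => (h1 i).2)
  have hT : conjBy (tensorPow T n) Z = (conjBy M Z).submatrix f f := rfl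
  rw [← conjBy_trace hM Z, hT]
  simp only [Matrix.trace, Matrix.diag, Complex.re_sum, submatrix_apply]
  have hpos : ∀ i, 0 ≤ (conjBy M Z i i).re := fun i =>
    (Complex.le_def.1 (conjBy_posSemidef M hZ).diag_nonneg).1
  exact (Finset.sum_map Finset.univ ⟨f, hf⟩ fun i => (conjBy M Z i i).re).symm.trans_le
    (Finset.sum_le_univ_sum_of_nonneg hpos)

/-- Hermiticity comes for free: `0 ≤` in `ℂ` includes being real, and a complex matrix with real
quadratic form is Hermitian. -/
theorem posSemidef_of_quadratic_nonneg [DecidableEq e] {Γ : Matrix e e ℂ}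
    (h : ∀ v : e → ℂ, 0 ≤ star v ⬝ᵥ Γ *ᵥ v) : Γ.PosSemidef := by
  rw [← isPositive_toEuclideanLin_iff, LinearMap.isPositive_iff_complex]
  intro v
  have h1 : inner ℂ (toEuclideanLin Γ v) v = star (star v.ofLp ⬝ᵥ Γ *ᵥ v.ofLp) := by
    rw [EuclideanSpace.inner_eq_star_dotProduct, dotProduct_star, dotProduct_comm]
    rfl
  have h2 := Complex.le_def.1 (h v.ofLp)
  rw [h1]
  refine ⟨Complex.ext (by simp) ?_, ?_⟩
  · simpa using h2.2.symm
  · simpa using h2.1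

/-- A positive functional on matrices is given by a positive semidefinite matrix. -/
theorem exists_posSemidef_of_functional [DecidableEq e] (g : Matrix e e ℂ →ₗ[ℂ] ℂ)
    (hg : ∀ Z : Matrix e e ℂ, Z.PosSemidef → 0 ≤ g Z) :
    ∃ Γ : Matrix e e ℂ, Γ.PosSemidef ∧ ∀ Z, (Γ * Z).trace = g Z := by
  have hv : ∀ v : e → ℂ, g (vecMulVec v (star v)) =
      ∑ i, ∑ j, star (v j) * (g (single i j 1) * v i) := by
    intro v
    have : vecMulVec v (star v) = ∑ i, ∑ j, (v i * star (v j)) • single i j (1 : ℂ) := by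
      conv_lhs => rw [Matrix.matrix_eq_sum_single (vecMulVec v (star v))]
      simp [vecMulVec_apply, Matrix.smul_single]
    rw [this]
    simp only [map_sum, map_smul, smul_eq_mul]
    exact Finset.sum_congr rfl fun i _ => Finset.sum_congr rfl fun j _ => by ring
  let Γ : Matrix e e ℂ := Matrix.of fun i j => g (single j i 1)
  have htr : ∀ Z, (Γ * Z).trace = g Z := by
    intro Z
    conv_rhs => rw [Matrix.matrix_eq_sum_single Z]
    simp only [map_sum]
    have : ∀ i j, g (single i j (Z i j)) = Z i j * g (single i j 1) := fun i j => by
      rw [← smul_eq_mul, ← map_smul, Matrix.smul_single, smul_eq_mul, mul_one]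
    simp only [this, Matrix.trace, Matrix.diag, Matrix.mul_apply, Γ, Matrix.of_apply]
    rw [Finset.sum_comm]
    exact Finset.sum_congr rfl fun i _ => Finset.sum_congr rfl fun j _ => by ring
  have hquad : ∀ v : e → ℂ, 0 ≤ star v ⬝ᵥ Γ *ᵥ v := by
    intro v
    have := hg _ (posSemidef_vecMulVec_self_star v)
    rw [hv, Finset.sum_comm] at this
    simpa [dotProduct, mulVec, Finset.mul_sum, Γ] using this
  exact ⟨Γ, posSemidef_of_quadratic_nonneg hquad, htr⟩

end TensorPower

/-! ### The converse bound -/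

section Angles

theorem angle_le_of_cos_le_inner {V : Type*} [NormedAddCommGroup V] [InnerProductSpace ℝ V]
    {x y : V} (hx : ‖x‖ = 1) (hy : ‖y‖ = 1) {θ : ℝ} (h0 : 0 ≤ θ)
    (hπ : θ ≤ Real.pi) (h : Real.cos θ ≤ inner ℝ x y) : InnerProductGeometry.angle x y ≤ θ := by
  rw [InnerProductGeometry.angle, hx, hy, mul_one, div_one, ← Real.arccos_cos h0 hπ]
  exact Real.arccos_le_arccos h

/-- The triangle inequality for angles, applied to square roots of sub-distributions. -/
theorem cos_add_le_sqrt {ι : Type*} [Fintype ι] {c : ℝ} (hc : 0 ≤ c)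
    (hcard : ∑ _i : ι, c = 1) {p q : ι → ℝ}
    (hp0 : ∀ i, 0 ≤ p i) (hp1 : ∀ i, p i ≤ c) (hq0 : ∀ i, 0 ≤ q i) (hq1 : ∀ i, q i ≤ c)
    (hq : ∑ i, q i ≤ c) {α β : ℝ} (hα : 0 ≤ α) (hβ : 0 ≤ β) (hαβ : α + β ≤ Real.pi)
    (h1 : Real.cos α ≤ ∑ i, √(p i) * √c)
    (h2 : Real.cos β ≤ ∑ i, (√(p i) * √(q i) + √(c - p i) * √(c - q i))) :
    Real.cos (α + β) ≤ √c := by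
  -- The second copy of `ι` carries the failure weights, which complete the sub-distributions to
  -- unit vectors.
  let x : EuclideanSpace ℝ (ι ⊕ ι) :=
    WithLp.toLp 2 (Sum.elim (fun i => √(p i)) fun i => √(c - p i))
  let y : EuclideanSpace ℝ (ι ⊕ ι) :=
    WithLp.toLp 2 (Sum.elim (fun i => √(q i)) fun i => √(c - q i))
  let z : EuclideanSpace ℝ (ι ⊕ ι) := WithLp.toLp 2 (Sum.elim (fun _ => √c) fun _ => 0)
  have hxx : ‖x‖ = 1 := by
    rw [EuclideanSpace.norm_eq, Real.sqrt_eq_one, ← hcard]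
    simp [x, Fintype.sum_sum_type, Real.sq_sqrt, hp0, hp1]
  have hyy : ‖y‖ = 1 := by
    rw [EuclideanSpace.norm_eq, Real.sqrt_eq_one, ← hcard]
    simp [y, Fintype.sum_sum_type, Real.sq_sqrt, hq0, hq1]
  have hzz : ‖z‖ = 1 := by
    rw [EuclideanSpace.norm_eq, Real.sqrt_eq_one, ← hcard]
    simp [z, Fintype.sum_sum_type, Real.sq_sqrt, hc]
  have hyx : Real.cos β ≤ inner ℝ y x := by
    refine h2.trans (le_of_eq ?_)
    simp [x, y, PiLp.inner_apply, Fintype.sum_sum_type, Finset.sum_add_distrib]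
  have hxz : Real.cos α ≤ inner ℝ x z := by
    refine h1.trans (le_of_eq ?_)
    simp [x, z, PiLp.inner_apply, Fintype.sum_sum_type, mul_comm]
  have hyz : inner ℝ y z = ∑ i, √(q i) * √c := by
    simp [y, z, PiLp.inner_apply, Fintype.sum_sum_type, mul_comm]
  have a1 := angle_le_of_cos_le_inner hxx hzz hα (by linarith) hxz
  have a2 := angle_le_of_cos_le_inner hyy hxx hβ (by linarith) hyx
  have a3 := InnerProductGeometry.angle_le_angle_add_angle y x z
  have a4 := Real.cos_le_cos_of_nonneg_of_le_pi (InnerProductGeometry.angle_nonneg y z) hαβ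
    (by linarith : InnerProductGeometry.angle y z ≤ α + β)
  rw [InnerProductGeometry.cos_angle, hyy, hzz, mul_one, div_one, hyz] at a4
  -- Cauchy–Schwarz with `∑ c = 1` leaves `√(∑ q)`.
  refine a4.trans ((Real.sum_sqrt_mul_sqrt_le _ hq0 fun _ => hc).trans ?_)
  rw [hcard, Real.sqrt_one, mul_one]
  exact Real.sqrt_le_sqrt hq

end Angles

/-! ### Block-diagonal operators over a message register -/

section Blocks

variable {a b r : Type*}

theorem posSemidef_single [Fintype r] [DecidableEq r] (s : r) :
    (single s s (1 : ℂ)).PosSemidef := by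
  rw [← Matrix.diagonal_single]
  exact PosSemidef.diagonal (Pi.single_nonneg.2 zero_le_one)

theorem posSemidef_of_block [Fintype a] [Fintype r] [DecidableEq r]
    {X : Matrix (a × r) (a × r) ℂ} (h0 : ∀ s t, s ≠ t → block X s t = 0)
    (h1 : ∀ s, (block X s s).PosSemidef) : X.PosSemidef := by
  have h : X = ∑ s, block X s s ⊗ₖ single s s 1 := by
    ext ⟨i, s⟩ ⟨j, t⟩
    by_cases hst : s = t
    · subst hst
      rw [Matrix.sum_apply, Finset.sum_eq_single s]
      · simp [block]
      · intro u _ hu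
        simp [hu]
      · simp
    · have h2 : X (i, s) (j, t) = 0 := congrFun (congrFun (h0 s t hst) i) j
      rw [h2, Matrix.sum_apply, Finset.sum_eq_zero]
      intro u _
      rw [kroneckerMap_apply, Matrix.single_apply, if_neg, mul_zero]
      rintro ⟨rfl, h3⟩
      exact hst h3
  rw [h]
  refine posSemidef_sum _ fun s _ => (h1 s).kronecker (posSemidef_single s)

theorem trace_kronecker_single_mul [Fintype a] [Fintype r] [DecidableEq r] (A : Matrix a a ℂ)
    (X : Matrix (a × r) (a × r) ℂ) (s : r) :
    ((A ⊗ₖ single s s (1 : ℂ)) * X).trace = (A * block X s s).trace := by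
  simp only [Matrix.trace, Matrix.diag, Matrix.mul_apply, Fintype.sum_prod_type, block,
    kroneckerMap_apply, Matrix.of_apply]
  refine Finset.sum_congr rfl fun i _ => ?_
  rw [Finset.sum_eq_single s]
  · refine Finset.sum_congr rfl fun j _ => ?_
    rw [Finset.sum_eq_single s]
    · simp
    · intro u _ hu
      simp [hu.symm]
    · simp
  · intro u _ hu
    simp [hu.symm]
  · simp

theorem sum_single_one [Fintype r] [DecidableEq r] :
    ∑ s : r, single s s (1 : ℂ) = 1 := by
  ext i j
  simp [Matrix.sum_apply, Matrix.single_apply, Matrix.one_apply, ite_and]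

theorem block_correlatedState (M : ℕ) (s t : Fin M) : block (correlatedState M) s t =
    if s = t then (1 / (M : ℂ)) • single s s 1 else 0 := by
  ext i j
  simp only [block, correlatedState, Matrix.of_apply, Matrix.sum_apply, Matrix.smul_apply,
    kroneckerMap_apply, smul_eq_mul, Matrix.single_apply]
  split_ifs with h
  · subst h
    rw [Finset.sum_eq_single s] <;> simp +contextual [Matrix.single_apply]
  · refine Finset.sum_eq_zero fun u _ => ?_
    have : ¬ (u = s ∧ u = t) := by
      rintro ⟨rfl, h2⟩
      exact h h2
    simp [this]

theorem uniformState_eq (M : ℕ) : uniformState M = (1 / (M : ℂ)) • 1 := by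
  rw [uniformState, ← Finset.smul_sum, sum_single_one]

theorem block_kronecker_uniformState {M : ℕ} (ω : Matrix a a ℂ) (s : Fin M) :
    block (ω ⊗ₖ uniformState M) s s = (1 / (M : ℂ)) • ω := by
  ext i j
  simp [block, uniformState_eq, mul_comm]

theorem one_div_natCast_nonneg (M : ℕ) : (0 : ℂ) ≤ 1 / (M : ℂ) := by
  have : (1 / (M : ℂ)) = ((1 / (M : ℝ) : ℝ) : ℂ) := by push_cast; rfl
  rw [this, Complex.zero_le_real]
  positivity

theorem correlatedState_posSemidef (M : ℕ) : (correlatedState M).PosSemidef := by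
  refine posSemidef_of_block (fun s t h => ?_) fun s => ?_
  · rw [block_correlatedState, if_neg h]
  · rw [block_correlatedState, if_pos rfl]
    exact (posSemidef_single s).smul (one_div_natCast_nonneg M)

theorem trSnd_tensorId {e : Type*} [Fintype e] (Φ : SuperOp a b)
    (X : Matrix (a × e) (a × e) ℂ) : trSnd b e (tensorId Φ e X) = Φ (trSnd a e X) := by
  have h : trSnd a e X = ∑ k, block X k k := by
    ext i j
    simp [trSnd, block, Matrix.sum_apply]
  rw [h, map_sum]
  ext i j
  simp only [Matrix.sum_apply]
  rfl

/-- Discarding the output of a trace-preserving map cancels the map. Thus the decoder drops out of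
the privacy condition. -/
theorem trFst_tensorId {e : Type*} [Fintype a] [Fintype b] {Φ : SuperOp a b} (hΦ : IsChannel Φ)
    (X : Matrix (a × e) (a × e) ℂ) : trFst b e (tensorId Φ e X) = trFst a e X := by
  ext i j
  exact hΦ.trace_preserving (block X i j)

end Blocks

/-! ### Reliability and privacy of a code, seen from the environment -/

section Codes

variable {a b e : Type*} [Fintype a]

/-- The reference register stays classical, so a code is analysed message by message; the weight `1
/ M` is kept inside the encoded operator. -/
theorem block_outputState (U : Matrix (b × e) a ℂ) {n M : ℕ}
    (enc : SuperOp (Fin M) (Fin n → a)) (dec : SuperOp (Fin n → b) (Fin M)) (s t : Fin M) :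
    block (outputState U enc dec) s t = if s = t then
      tensorId dec (Fin n → e) (conjBy (tensorPow U n) (enc ((1 / (M : ℂ)) • single s s 1)))
      else 0 := by
  rw [outputState, block_tensorId, block_tensorId, block_tensorId, block_correlatedState]
  split_ifs
  · rfl
  · simp

variable {U : Matrix (b × e) a ℂ} {n M : ℕ} {ε δ : ℝ}

theorem encoded_posSemidef {enc : SuperOp (Fin M) (Fin n → a)} (henc : IsChannel enc)
    (m : Fin M) : (enc ((1 / (M : ℂ)) • single m m 1)).PosSemidef :=
  henc.posSemidef ((posSemidef_single m).smul (one_div_natCast_nonneg M))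

theorem encoded_trace {enc : SuperOp (Fin M) (Fin n → a)} (henc : IsChannel enc)
    (m : Fin M) : (enc ((1 / (M : ℂ)) • single m m 1)).trace = 1 / (M : ℂ) := by
  rw [henc.trace_preserving, Matrix.trace_smul, Matrix.trace_single_eq_same, smul_eq_mul, mul_one]

theorem block_message_output [Fintype e] (enc : SuperOp (Fin M) (Fin n → a))
    (dec : SuperOp (Fin n → b) (Fin M)) (s t : Fin M) :
    block (tensorId (trSnd (Fin M) (Fin n → e)) (Fin M) (outputState U enc dec)) s t =
      if s = t then dec (trSnd _ _ (conjBy (tensorPow U n) (enc ((1 / (M : ℂ)) • single s s 1))))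
      else 0 := by
  rw [block_tensorId, block_outputState]
  split_ifs
  · rw [trSnd_tensorId]
  · simp

theorem block_environment_output [Fintype b] (enc : SuperOp (Fin M) (Fin n → a))
    {dec : SuperOp (Fin n → b) (Fin M)} (hdec : IsChannel dec) (s t : Fin M) :
    block (tensorId (trFst (Fin M) (Fin n → e)) (Fin M) (outputState U enc dec)) s t =
      if s = t then complementary (tensorPow U n) (enc ((1 / (M : ℂ)) • single s s 1))
      else 0 := by
  rw [block_tensorId, block_outputState]
  split_ifs
  · rw [trFst_tensorId hdec]
    rfl
  · simp

variable [Fintype b] [Fintype e]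

theorem message_output_posSemidef {enc : SuperOp (Fin M) (Fin n → a)} (henc : IsChannel enc)
    {dec : SuperOp (Fin n → b) (Fin M)} (hdec : IsChannel dec) :
    (tensorId (trSnd (Fin M) (Fin n → e)) (Fin M) (outputState U enc dec)).PosSemidef := by
  refine posSemidef_of_block (fun s t h => ?_) fun s => ?_
  · rw [block_message_output, if_neg h]
  · rw [block_message_output, if_pos rfl]
    exact hdec.posSemidef (trSnd_posSemidef (conjBy_posSemidef _ (encoded_posSemidef henc s)))

theorem environment_output_posSemidef {enc : SuperOp (Fin M) (Fin n → a)} (henc : IsChannel enc)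
    {dec : SuperOp (Fin n → b) (Fin M)} (hdec : IsChannel dec) :
    (tensorId (trFst (Fin M) (Fin n → e)) (Fin M) (outputState U enc dec)).PosSemidef := by
  refine posSemidef_of_block (fun s t h => ?_) fun s => ?_
  · rw [block_environment_output _ hdec, if_neg h]
  · rw [block_environment_output _ hdec, if_pos rfl]
    exact trFst_posSemidef (conjBy_posSemidef _ (encoded_posSemidef henc s))

/-- Both registers are measured in the message basis. The correlated state charges only coinciding
outcomes, so only the probabilities of correct decoding survive. -/
theorem fidelity_message_le {enc : SuperOp (Fin M) (Fin n → a)} (henc : IsChannel enc)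
    {dec : SuperOp (Fin n → b) (Fin M)} (hdec : IsChannel dec) :
    fidelity (tensorId (trSnd (Fin M) (Fin n → e)) (Fin M) (outputState U enc dec))
      (correlatedState M) ≤
    ∑ m, √(dec (trSnd _ _ (conjBy (tensorPow U n) (enc ((1 / (M : ℂ)) • single m m 1)))) m m).re *
      √(1 / (M : ℝ)) := by
  refine (fidelity_le_sum_measurement (message_output_posSemidef henc hdec)
    (correlatedState_posSemidef M) (fun p : Fin M × Fin M => single p p 1)
    (fun p => posSemidef_single p) sum_single_one).trans (le_of_eq ?_)
  have hentry : ∀ (X : Matrix (Fin M × Fin M) (Fin M × Fin M) ℂ) p,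
      (single p p (1 : ℂ) * X).trace = block X p.2 p.2 p.1 p.1 := by
    intro X p
    rw [Matrix.trace_single_mul]
    simp [block]
  simp only [hentry, block_message_output, block_correlatedState, if_true]
  rw [Fintype.sum_prod_type_right]
  refine Finset.sum_congr rfl fun m _ => ?_
  rw [Finset.sum_eq_single m]
  · congr 2
    rw [Matrix.smul_apply, Matrix.single_apply_same, smul_eq_mul, mul_one]
    have : (1 / (M : ℂ)) = ((1 / (M : ℝ) : ℝ) : ℂ) := by push_cast; rfl
    rw [this, Complex.ofReal_re]
  · intro j _ hj
    rw [Matrix.smul_apply, Matrix.single_apply_of_ne _ _ _ _ _ (fun h => hj h.1.symm)]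
    simp
  · simp

variable [DecidableEq a] [DecidableEq b] [DecidableEq e]

/-- Effects on the environment that sum to at most the identity and reproduce the statistics of
any decoder acting on the output of the channel. -/
theorem exists_environment_effects {N : SuperOp a b} (hanti : IsAntidegradable N)
    (hU : IsIsometricExtension U N) {ι : Type*} [Fintype ι]
    {dec : SuperOp (Fin n → b) ι} (hdec : IsChannel dec) :
    ∃ Γ Γ' : ι → Matrix (Fin n → e) (Fin n → e) ℂ,
      (∀ m, (Γ m).PosSemidef) ∧ (∀ m, (Γ' m).PosSemidef) ∧ (∀ m, Γ m + Γ' m = 1) ∧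
      (∀ m X, (Γ m * complementary (tensorPow U n) X).trace =
        dec (trSnd _ _ (conjBy (tensorPow U n) X)) m m) ∧
      ∀ Z : Matrix (Fin n → e) (Fin n → e) ℂ, Z.PosSemidef →
        ∑ m, (Γ m * Z).trace.re ≤ Z.trace.re := by
  obtain ⟨k, T, S, hT, hrec⟩ := hanti.exists_recovery hU
  -- The simulated decoder: recover the channel output from the environment, then decode. The
  -- effects are its outcomes in the Heisenberg picture.
  let R : SuperOp (Fin n → e) ι :=
    dec ∘ₗ trSnd (Fin n → b) (Fin n → b × Fin k) ∘ₗ conjBy (tensorPow T n)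
  have hR : ∀ Z : Matrix (Fin n → e) (Fin n → e) ℂ, Z.PosSemidef → (R Z).PosSemidef := fun Z hZ =>
    hdec.posSemidef (trSnd_posSemidef (conjBy_posSemidef _ hZ))
  have hRtr : ∀ Z : Matrix (Fin n → e) (Fin n → e) ℂ, Z.PosSemidef →
      (R Z).trace.re ≤ Z.trace.re := fun Z hZ => by
    have h : (R Z).trace = (conjBy (tensorPow T n) Z).trace :=
      (hdec.trace_preserving _).trans (trSnd_trace _)
    rw [h]
    exact re_trace_conjBy_tensorPow_le hT n hZ
  have hle : ∀ m (Z : Matrix (Fin n → e) (Fin n → e) ℂ), Z.PosSemidef → R Z m m ≤ Z.trace := by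
    intro m Z hZ
    have h1 : R Z m m ≤ (R Z).trace :=
      Finset.single_le_sum (f := fun i => R Z i i) (fun i _ => (hR Z hZ).diag_nonneg)
        (Finset.mem_univ m)
    refine h1.trans (Complex.le_def.2 ⟨hRtr Z hZ, ?_⟩)
    rw [← (Complex.le_def.1 (hR Z hZ).trace_nonneg).2, ← (Complex.le_def.1 hZ.trace_nonneg).2]
  choose Γ hΓ hΓtr using fun m : ι => exists_posSemidef_of_functional
    (entryLinearMap ℂ ℂ m m ∘ₗ R) fun Z hZ => (hR Z hZ).diag_nonneg
  -- `Γ' m` represents every outcome other than `m`, including the trace that the recovery may lose.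
  choose Γ' hΓ' hΓtr' using fun m : ι => exists_posSemidef_of_functional
    (traceLinearMap (Fin n → e) ℂ ℂ - entryLinearMap ℂ ℂ m m ∘ₗ R)
    fun Z hZ => sub_nonneg.2 (hle m Z hZ)
  refine ⟨Γ, Γ', hΓ, hΓ', fun m => ?_, fun m X => ?_, fun Z hZ => ?_⟩
  · refine Matrix.ext_iff_trace_mul_right.2 fun Z => ?_
    rw [Matrix.add_mul, Matrix.trace_add, hΓtr, hΓtr', Matrix.one_mul]
    simp
  · rw [hΓtr]
    have h := LinearMap.congr_fun (tensorPow_recovery hrec n) X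
    simp only [LinearMap.comp_apply] at h
    rw [h]
    rfl
  · simp only [hΓtr]
    refine le_trans (le_of_eq ?_) (hRtr Z hZ)
    simp [Matrix.trace]

theorem PrivateCode.cos_le {N : SuperOp a b} (hanti : IsAntidegradable N)
    (hU : IsIsometricExtension U N) (hM : 0 < M) (C : PrivateCode U n M ε δ)
    (hε : 0 ≤ ε) (hδ : 0 ≤ δ) (hεδ : Real.arcsin ε + Real.arcsin δ ≤ Real.pi / 2) :
    Real.cos (Real.arcsin ε + Real.arcsin δ) ≤ √(1 / (M : ℝ)) := by
  obtain ⟨enc, henc, dec, hdec, ω, hω, herr, hpriv⟩ := C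
  obtain ⟨Γ, Γ', hΓ, hΓ', hadd, hdecΓ, hsum⟩ :=
    exists_environment_effects hanti hU (n := n) hdec
  let σ : Fin M → Matrix (Fin n → e) (Fin n → e) ℂ := fun m =>
    complementary (tensorPow U n) (enc ((1 / (M : ℂ)) • single m m 1))
  have hσ : ∀ m, (σ m).PosSemidef := fun m =>
    trFst_posSemidef (conjBy_posSemidef _ (encoded_posSemidef henc m))
  let τ : Matrix (Fin n → e) (Fin n → e) ℂ := (1 / (M : ℂ)) • ω
  have hτ : τ.PosSemidef := hω.1.smul (one_div_natCast_nonneg M)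
  have hre : (1 / (M : ℂ)) = ((1 / (M : ℝ) : ℝ) : ℂ) := by push_cast; rfl
  have hστr : ∀ m, (σ m).trace.re = 1 / (M : ℝ) := by
    intro m
    have h : (σ m).trace = 1 / (M : ℂ) := (trFst_trace _).trans
      ((conjBy_trace (tensorPow_isometry hU.isometry n) _).trans (encoded_trace henc m))
    rw [h, hre, Complex.ofReal_re]
  have hτtr : τ.trace.re = 1 / (M : ℝ) := by
    rw [Matrix.trace_smul, hω.2, smul_eq_mul, mul_one, hre, Complex.ofReal_re]
  have hcompl : ∀ m (Z : Matrix (Fin n → e) (Fin n → e) ℂ),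
      (Γ' m * Z).trace.re = Z.trace.re - (Γ m * Z).trace.re := by
    intro m Z
    have h := congrArg (fun A => (A * Z).trace.re) (hadd m)
    simp only [Matrix.add_mul, Matrix.trace_add, Complex.add_re, Matrix.one_mul] at h
    linarith
  have hle : ∀ m (Z : Matrix (Fin n → e) (Fin n → e) ℂ), Z.PosSemidef →
      (Γ m * Z).trace.re ≤ Z.trace.re := fun m Z hZ => by
    have := trace_mul_nonneg_re (hΓ' m) hZ
    rw [hcompl] at this
    linarith
  -- Both weights contain the prior `1 / M`. The bound on `∑ q` holds because `τ` is the same for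
  -- all messages.
  refine cos_add_le_sqrt (ι := Fin M) (c := 1 / (M : ℝ)) (p := fun m => (Γ m * σ m).trace.re)
    (q := fun m => (Γ m * τ).trace.re) (by positivity) ?_
    (fun m => trace_mul_nonneg_re (hΓ m) (hσ m)) (fun m => (hle m _ (hσ m)).trans_eq (hστr m))
    (fun m => trace_mul_nonneg_re (hΓ m) hτ) (fun m => (hle m _ hτ).trans_eq hτtr)
    ((hsum τ hτ).trans_eq hτtr) (Real.arcsin_nonneg.2 hε) (Real.arcsin_nonneg.2 hδ)
    (by linarith [Real.pi_pos]) ?_ ?_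
  · rw [Finset.sum_const, Finset.card_univ, Fintype.card_fin, nsmul_eq_mul]
    field_simp
  · rw [Real.cos_arcsin]
    refine (sqrt_one_sub_sq_le_fidelity herr).trans ((fidelity_message_le henc hdec).trans
      (le_of_eq ?_))
    simp only [σ, hdecΓ]
  · rw [Real.cos_arcsin]
    -- The measurement reads the message `m` from the register and then tests the environment with
    -- the pair `Γ m`, `Γ' m`.
    let E : Fin M ⊕ Fin M → Matrix ((Fin n → e) × Fin M) ((Fin n → e) × Fin M) ℂ :=
      Sum.elim (fun m => Γ m ⊗ₖ single m m 1) fun m => Γ' m ⊗ₖ single m m 1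
    have hE : ∀ i, (E i).PosSemidef := by
      rintro (m | m)
      · exact (hΓ m).kronecker (posSemidef_single m)
      · exact (hΓ' m).kronecker (posSemidef_single m)
    have hEsum : ∑ i, E i = 1 := by
      rw [Fintype.sum_sum_type, ← Finset.sum_add_distrib]
      simp only [E, Sum.elim_inl, Sum.elim_inr, ← add_kronecker, hadd]
      rw [← one_kronecker_one, ← sum_single_one (r := Fin M)]
      ext i j
      simp [Matrix.sum_apply, Finset.mul_sum]
    have huni : (uniformState M).PosSemidef := by
      rw [uniformState_eq]
      exact PosSemidef.one.smul (one_div_natCast_nonneg M)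
    refine (sqrt_one_sub_sq_le_fidelity hpriv).trans ((fidelity_le_sum_measurement
      (environment_output_posSemidef henc hdec) (hω.1.kronecker huni) E hE hEsum).trans
      (le_of_eq ?_))
    rw [Fintype.sum_sum_type, ← Finset.sum_add_distrib]
    simp only [E, Sum.elim_inl, Sum.elim_inr, trace_kronecker_single_mul,
      block_environment_output _ hdec, if_true, block_kronecker_uniformState]
    refine Finset.sum_congr rfl fun m _ => ?_
    rw [hcompl m (complementary _ _), hcompl m ((1 / (M : ℂ)) • ω)]
    rw [show (complementary (tensorPow U n) (enc ((1 / (M : ℂ)) • single m m 1))).trace.re =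
      1 / (M : ℝ) from hστr m, show ((1 / (M : ℂ)) • ω).trace.re = 1 / (M : ℝ) from hτtr]

end Codes

/-! ### A code with one message -/

section OneMessage

theorem isChannel_conjBy {a c : Type*} [Fintype a] [DecidableEq a] [Fintype c] {V : Matrix c a ℂ}
    (hV : Vᴴ * V = 1) : IsChannel (conjBy V) := by
  refine ⟨fun k X hX => ?_, conjBy_trace hV⟩
  have h : tensorId (conjBy V) (Fin k) X =
      (V ⊗ₖ (1 : Matrix (Fin k) (Fin k) ℂ)) * X * (V ⊗ₖ (1 : Matrix (Fin k) (Fin k) ℂ))ᴴ := by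
    ext ⟨p, s⟩ ⟨q, t⟩
    change (V * block X s t * Vᴴ) p q = _
    simp [Matrix.mul_apply, Fintype.sum_prod_type, block, Matrix.one_apply,
      apply_ite (starRingEnd ℂ)]
  rw [h]
  exact hX.mul_mul_conjTranspose_same _

/-- The channel that discards a system. -/
def discard (b : Type*) [Fintype b] : SuperOp b (Fin 1) :=
  (traceLinearMap b ℂ ℂ).smulRight 1

theorem discard_apply {b : Type*} [Fintype b] (X : Matrix b b ℂ) :
    discard b X = X.trace • (1 : Matrix (Fin 1) (Fin 1) ℂ) := rfl

theorem isChannel_discard (b : Type*) [Fintype b] : IsChannel (discard b) := by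
  refine ⟨fun k X hX => ?_, fun X => by simp [discard_apply]⟩
  have h : tensorId (discard b) (Fin k) X = (trFst b (Fin k) X).submatrix Prod.snd Prod.snd := by
    ext ⟨p, s⟩ ⟨q, t⟩
    change discard b (block X s t) p q = _
    simp [discard_apply, Subsingleton.elim p q, trFst, Matrix.trace, block]
  rw [h]
  exact (trFst_posSemidef hX).submatrix _

/-- The isometry that prepares a basis state. -/
def preparation {α : Type*} [DecidableEq α] (x : α) : Matrix α (Fin 1) ℂ :=
  Matrix.of fun i _ => if i = x then 1 else 0

theorem preparation_isometry {α : Type*} [Fintype α] [DecidableEq α] (x : α) :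
    (preparation x)ᴴ * preparation x = 1 := by
  ext i j
  obtain rfl := Subsingleton.elim i j
  simp [preparation, Matrix.mul_apply]

theorem eq_of_block_eq {α : Type*} {X Y : Matrix (α × Fin 1) (α × Fin 1) ℂ}
    (h : block X 0 0 = block Y 0 0) : X = Y := by
  ext ⟨i, s⟩ ⟨j, t⟩
  rw [Subsingleton.elim s 0, Subsingleton.elim t 0]
  exact congrFun (congrFun h i) j

variable {a b e : Type*} [Fintype a] [DecidableEq a] [Fintype b] [Fintype e] [DecidableEq e]

/-- A fixed input, a decoder that discards everything, and the actual environment state as `omega`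
make both distances zero. This code makes the maximum exist and the rates non-negative. -/
theorem one_mem_privateSizes [Nonempty a] {U : Matrix (b × e) a ℂ} (hU : Uᴴ * U = 1) (n : ℕ)
    {ε δ : ℝ} (hε : 0 ≤ ε) (hδ : 0 ≤ δ) : 1 ∈ privateSizes U n ε δ := by
  let x : Fin n → a := fun _ => Classical.arbitrary a
  have henc : IsChannel (conjBy (preparation x)) := isChannel_conjBy (preparation_isometry x)
  have hdec := isChannel_discard (Fin n → b)
  have hUn := tensorPow_isometry hU n
  let R : Matrix (Fin n → a) (Fin n → a) ℂ :=
    conjBy (preparation x) ((1 / ((1 : ℕ) : ℂ)) • single 0 0 1)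
  have hR : (conjBy (tensorPow U n) R).PosSemidef :=
    conjBy_posSemidef _ (encoded_posSemidef henc 0)
  have hRtr : (conjBy (tensorPow U n) R).trace = 1 := by
    rw [conjBy_trace hUn, encoded_trace henc]
    simp
  have hω : IsState (complementary (tensorPow U n) R) :=
    ⟨trFst_posSemidef hR, (trFst_trace _).trans hRtr⟩
  refine ⟨one_pos, ⟨⟨conjBy (preparation x), henc, discard _, hdec, _, hω, ?_, ?_⟩⟩⟩
  · have h : tensorId (trSnd (Fin 1) (Fin n → e)) (Fin 1)
        (outputState U (conjBy (preparation x)) (discard (Fin n → b))) = correlatedState 1 := by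
      refine eq_of_block_eq ?_
      rw [block_message_output, block_correlatedState, if_pos rfl, if_pos rfl, discard_apply,
        trSnd_trace, hRtr]
      ext i j
      simp [Subsingleton.elim i 0, Subsingleton.elim j 0]
    rw [h, purifiedDist_self ⟨correlatedState_posSemidef 1, ?_⟩]
    · exact hε
    · simp [correlatedState, Matrix.trace_kronecker]
  · have h : tensorId (trFst (Fin 1) (Fin n → e)) (Fin 1)
        (outputState U (conjBy (preparation x)) (discard (Fin n → b))) =
        complementary (tensorPow U n) R ⊗ₖ uniformState 1 := by
      refine eq_of_block_eq ?_
      rw [block_environment_output _ hdec, if_pos rfl, block_kronecker_uniformState]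
      simp [R]
    have huni : uniformState 1 = 1 := by simp [uniformState_eq]
    rw [h, huni, purifiedDist_self]
    · exact hδ
    · exact ⟨hω.1.kronecker PosSemidef.one, by simp [Matrix.trace_kronecker, hω.2]⟩

end OneMessage

/-! ### Strong converse -/

section StrongConverse

variable {a b e : Type*} [Fintype a] [Fintype b] [Fintype e] [DecidableEq e]
  {U : Matrix (b × e) a ℂ} {n : ℕ} {ε δ : ℝ}

theorem maxMessages_eq_of_isGreatest {K : ℕ} (h : IsGreatest (privateSizes U n ε δ) K) :
    maxMessages U n ε δ = (K : ℕ∞) :=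
  le_antisymm (iSup₂_le fun _ hM => by exact_mod_cast h.2 hM)
    (le_iSup₂ (f := fun (M : ℕ) (_ : M ∈ privateSizes U n ε δ) => (M : ℕ∞)) K h.1)

theorem privateRate_eq {K : ℕ} (hK : 1 ≤ K) (h : maxMessages U n ε δ = (K : ℕ∞)) :
    privateRate U n ε δ = (((n : ℝ)⁻¹ * Real.logb 2 K : ℝ) : EReal) := by
  have h1 : ENNReal.log ((K : ℕ∞) : ℝ≥0∞) = ((Real.log K : ℝ) : EReal) := by
    have : (((K : ℕ∞) : ℝ≥0∞)) = ENNReal.ofReal K := by simp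
    rw [this, ENNReal.log_ofReal_of_pos (by exact_mod_cast hK)]
  rw [privateRate, h, h1, ← EReal.coe_div, ← EReal.coe_mul]
  rfl

variable [DecidableEq a]

theorem privateRate_nonneg [Nonempty a] (hU : Uᴴ * U = 1) (n : ℕ) (hε : 0 ≤ ε) (hδ : 0 ≤ δ) :
    0 ≤ privateRate U n ε δ := by
  have h1 : (1 : ℕ∞) ≤ maxMessages U n ε δ := by
    have := le_iSup₂ (f := fun (M : ℕ) (_ : M ∈ privateSizes U n ε δ) => (M : ℕ∞)) 1
      (one_mem_privateSizes hU n hε hδ)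
    exact_mod_cast this
  have h2 : (1 : ℝ≥0∞) ≤ (maxMessages U n ε δ : ℝ≥0∞) := by exact_mod_cast h1
  refine mul_nonneg (EReal.coe_nonneg.2 (by positivity)) (EReal.div_nonneg ?_ ?_)
  · exact ENNReal.zero_le_log_iff.2 h2
  · exact EReal.coe_nonneg.2 (Real.log_nonneg one_le_two)

variable [DecidableEq b]

/-- The strict hypothesis says `sin (α + β) < 1`, which excludes the endpoint `α + β = π / 2`. -/
theorem cos_arcsin_add_arcsin_pos
    (h : δ * √(1 - ε ^ 2) + ε * √(1 - δ ^ 2) < 1)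
    (hε0 : 0 ≤ ε) (hε1 : ε ≤ 1) (hδ0 : 0 ≤ δ) (hδ1 : δ ≤ 1)
    (hεδ : Real.arcsin ε + Real.arcsin δ ≤ Real.pi / 2) :
    0 < Real.cos (Real.arcsin ε + Real.arcsin δ) := by
  have h0 := Real.arcsin_nonneg.2 hε0
  have h1 := Real.arcsin_nonneg.2 hδ0
  refine Real.cos_pos_of_mem_Ioo ⟨by linarith [Real.pi_pos], hεδ.lt_of_ne fun h2 => ?_⟩
  have h3 := congrArg Real.sin h2
  rw [Real.sin_pi_div_two, Real.sin_add, Real.cos_arcsin, Real.cos_arcsin,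
    Real.sin_arcsin (by linarith) hε1, Real.sin_arcsin (by linarith) hδ1] at h3
  linarith

theorem isGreatest_privateSizes [Nonempty a] {N : SuperOp a b} (hanti : IsAntidegradable N)
    (hU : IsIsometricExtension U N) (n : ℕ) (hε0 : 0 ≤ ε) (hδ0 : 0 ≤ δ)
    (hεδ : Real.arcsin ε + Real.arcsin δ ≤ Real.pi / 2)
    (hcos : 0 < Real.cos (Real.arcsin ε + Real.arcsin δ)) :
    ∃ K : ℕ, IsGreatest (privateSizes U n ε δ) K ∧ 1 ≤ K ∧
      (K : ℝ) ≤ (1 / Real.cos (Real.arcsin ε + Real.arcsin δ)) ^ 2 := by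
  set c := Real.cos (Real.arcsin ε + Real.arcsin δ)
  have hbound : ∀ M ∈ privateSizes U n ε δ, (M : ℝ) ≤ (1 / c) ^ 2 := by
    rintro M ⟨hM, ⟨C⟩⟩
    have h := C.cos_le hanti hU hM hε0 hδ0 hεδ
    have h2 : c ^ 2 ≤ 1 / (M : ℝ) := (Real.le_sqrt' hcos).1 h
    have hM' : (0 : ℝ) < M := Nat.cast_pos.2 hM
    rw [div_pow, one_pow, le_div_iff₀ (by positivity), mul_comm]
    exact (le_div_iff₀ hM').1 h2
  have hbdd : BddAbove (privateSizes U n ε δ) :=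
    ⟨⌊(1 / c) ^ 2⌋₊, fun M hM => Nat.le_floor (hbound M hM)⟩
  have hne : (privateSizes U n ε δ).Nonempty := ⟨1, one_mem_privateSizes hU.isometry n hε0 hδ0⟩
  have hg : IsGreatest (privateSizes U n ε δ) (sSup (privateSizes U n ε δ)) :=
    ⟨Nat.sSup_mem hne hbdd, fun _ hM => le_csSup hbdd hM⟩
  exact ⟨_, hg, hg.1.1, hbound _ hg.1⟩

theorem tendsto_privateRate [Nonempty a] {N : SuperOp a b} (hanti : IsAntidegradable N)
    (hU : IsIsometricExtension U N) (hε0 : 0 ≤ ε) (hδ0 : 0 ≤ δ)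
    (hεδ : Real.arcsin ε + Real.arcsin δ ≤ Real.pi / 2)
    (hcos : 0 < Real.cos (Real.arcsin ε + Real.arcsin δ)) :
    Filter.Tendsto (fun n : ℕ => privateRate U n ε δ) Filter.atTop (𝓝 0) := by
  set c := Real.cos (Real.arcsin ε + Real.arcsin δ) with hc
  have hlim : Filter.Tendsto (fun n : ℕ => (((n : ℝ)⁻¹ * Real.logb 2 ((1 / c) ^ 2) : ℝ) : EReal))
      Filter.atTop (𝓝 0) := by
    have h := (tendsto_inv_atTop_nhds_zero_nat (𝕜 := ℝ)).mul_const (Real.logb 2 ((1 / c) ^ 2))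
    rw [zero_mul] at h
    exact (continuous_coe_real_ereal.tendsto 0).comp h
  refine tendsto_of_tendsto_of_tendsto_of_le_of_le tendsto_const_nhds hlim
    (fun n => privateRate_nonneg hU.isometry n hε0 hδ0) fun n => ?_
  obtain ⟨K, hK, hK1, hKc⟩ := isGreatest_privateSizes hanti hU n hε0 hδ0 hεδ hcos
  simp only [privateRate_eq hK1 (maxMessages_eq_of_isGreatest hK)]
  refine EReal.coe_le_coe_iff.2 (mul_le_mul_of_nonneg_left ?_ (by positivity))
  exact Real.logb_le_logb_of_le one_lt_two (by exact_mod_cast hK1) hKc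

theorem privateCapacity_eq_zero [Nonempty a] {N : SuperOp a b} (hanti : IsAntidegradable N)
    (hU : IsIsometricExtension U N) : privateCapacity U = 0 := by
  refine le_antisymm ?_ (le_iInf fun ε => le_iInf fun δ => le_iInf fun hε => le_iInf fun hδ => ?_)
  -- One admissible pair bounds the infimum from above: `ε = δ = 1/2` gives total angle at most `π /
  -- 3 < π / 2`.
  · have h1 : Real.arcsin (1 / 2) ≤ Real.pi / 6 := by
      rw [← Real.sin_pi_div_six, Real.arcsin_sin] <;> linarith [Real.pi_pos]
    have h0 : 0 ≤ Real.arcsin (1 / 2) := Real.arcsin_nonneg.2 (by norm_num)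
    have hcos : 0 < Real.cos (Real.arcsin (1 / 2) + Real.arcsin (1 / 2)) :=
      Real.cos_pos_of_mem_Ioo ⟨by linarith [Real.pi_pos], by linarith [Real.pi_pos]⟩
    have ht := tendsto_privateRate (ε := 1 / 2) (δ := 1 / 2) hanti hU (by norm_num) (by norm_num)
      (by linarith [Real.pi_pos]) hcos
    have hpos : (0 : ℝ) < 1 / 2 := one_half_pos
    exact iInf_le_of_le (1 / 2) (iInf_le_of_le (1 / 2) (iInf_le_of_le hpos
      (iInf_le_of_le hpos ht.liminf_eq.le)))
  · exact Filter.le_liminf_of_le (by isBoundedDefault)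
      (Filter.Eventually.of_forall fun n => privateRate_nonneg hU.isometry n hε.le hδ.le)

end StrongConverse

end QInfo

theorem mainTheorem1 {a b e : Type*} [Fintype a] [DecidableEq a] [Nonempty a]
    [Fintype b] [DecidableEq b] [Fintype e] [DecidableEq e]
    (N : SuperOp a b) (hN : IsChannel N) (hanti : IsAntidegradable N)
    (U : Matrix (b × e) a ℂ) (hU : IsIsometricExtension U N) :
    (∀ ε δ : ℝ, 0 ≤ ε → ε ≤ 1 → 0 ≤ δ → δ ≤ 1 →
      δ * Real.sqrt (1 - ε ^ 2) + ε * Real.sqrt (1 - δ ^ 2) < 1 →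
      Real.arcsin ε + Real.arcsin δ ≤ Real.pi / 2 →
        (∀ n : ℕ, ∃ K : ℕ, IsGreatest (privateSizes U n ε δ) K ∧
          maxMessages U n ε δ = (K : ℕ∞) ∧
          Real.logb 2 (K : ℝ) ≤
            2 * Real.logb 2 (1 / Real.cos (Real.arcsin ε + Real.arcsin δ))) ∧
        Filter.Tendsto (fun n : ℕ => privateRate U n ε δ) Filter.atTop (𝓝 0)) ∧
    privateCapacity U = 0 := by
  refine ⟨fun ε δ hε0 hε1 hδ0 hδ1 h hεδ => ?_, privateCapacity_eq_zero hanti hU⟩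
  have hcos := cos_arcsin_add_arcsin_pos h hε0 hε1 hδ0 hδ1 hεδ
  refine ⟨fun n => ?_, tendsto_privateRate hanti hU hε0 hδ0 hεδ hcos⟩
  obtain ⟨K, hK, hK1, hKc⟩ := isGreatest_privateSizes hanti hU n hε0 hδ0 hεδ hcos
  refine ⟨K, hK, maxMessages_eq_of_isGreatest hK, ?_⟩
  have h2 := Real.logb_le_logb_of_le one_lt_two (by exact_mod_cast hK1) hKc
  rwa [Real.logb_pow, Nat.cast_ofNat] at h2
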